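/- Let $N\ge 0$, let $q\in\mathbb C\setminus\{0\}$ with $q^2\neq 1$, and let $\eta_1,\dots,\eta_N\in\mathbb C\setminus\{0\}$ satisfy $$\eta_a^2\neq q^{2j}\eta_b^2\qquad\text{for all } 1\le b<a\le N,\ j\in\{-1,0,1\}.$$ On $\mathcal R_N=(\mathbb C^2)^{\otimes N}$ let $\sigma_n^{z},\sigma_n^{\pm}$ be the Pauli matrix $\sigma^z$ and the raising/lowering matrices acting at site $n$, put $x_\pm(\lambda)=\tfrac12\big(\lambda q-(q\lambda)^{-1}\pm(\lambda-\lambda^{-1})\big)$, $$L_n(\lambda)=\begin{pmatrix}x_+(\lambda)+x_-(\lambda)\sigma_n^z & (q-q^{-1})\sigma_n^-\\ (q-q^{-1})\sigma_n^+ & x_+(\lambda)-x_-(\lambda)\sigma_n^z\end{pmatrix},\qquad \begin{pmatrix}A(\lambda)&B(\lambda)\\ C(\lambda)&D(\lambda)\end{pmatrix}=L_N(\lambda/\eta_N)\cdots L_1(\lambda/\eta_1),$$ $a(\lambda)=-\prod_n\big(\tfrac{\lambda q}{\eta_n}-\tfrac{\eta_n}{\lambda q}\big)$, $d(\lambda)=\prod_n\big(\tfrac{\lambda}{\eta_n}-\tfrac{\eta_n}{\lambda}\big)$.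 Let $|0\rangle$ be the all-spins-up vector, $\langle 0|$ the corresponding covector of the dual basis, and let $\nu$ be any complex number with $\nu^2=\prod_{1\le b<a\le N}(\eta_a/\eta_b-\eta_b/\eta_a)$. For $h=(h_1,\dots,h_N)\in\{0,1\}^N$ define (products ordered by increasing $n$) $$\langle h|=\frac1\nu\langle 0|\prod_{n=1}^N\Big(\frac{C(\eta_n)}{d(\eta_n/q)}\Big)^{h_n},\qquad |h\rangle=\frac1\nu\prod_{n=1}^N\Big(\frac{B(\eta_n)}{a(\eta_n)}\Big)^{h_n}|0\rangle .$$ Let $U^{(L)}$ be the $2^N\times 2^N$ matrix whose row $h$ holds the coordinates of $\langle h|$ in the dual spin basis, and $U^{(R)}$ the matrix whose column $h$ holds the coordinates of $|h\rangle$ in the spin basis. Then $M=U^{(L)}U^{(R)}$ is diagonal, and for every $h$ $$M_{hh}=\langle h|h\rangle=\prod_{1\le b<a\le N}\frac{1}{\eta_a q^{h_b-h_a}/\eta_b-\eta_b/(q^{h_b-h_a}\eta_a)}\neq 0 .$$ Moreover, with Sklyanin's measure $\mu_h=1/\langle h|h\rangle$ and $\omega(x)=x^{N-1}$, $$\mathbb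 I=\sum_{h\in\{0,1\}^N}\mu_h\,|h\rangle\langle h|=\sum_{h\in\{0,1\}^N}\ \prod_{1\le b<a\le N}\big(\eta_a^2q^{-2h_a}-\eta_b^2q^{-2h_b}\big)\,\frac{|h\rangle\langle h|}{\prod_{b=1}^N\omega(\eta_b q^{-h_b})}.$$ -/

import Mathlib

noncomputable section

namespace XXZ

open Matrix

/-- Labels of the product basis of the chain with `N` sites. At each site, label `k : Fin 2` stands
for the spin state `|2k - 1, n⟩`, so `1` is spin up and `0` is spin down. The same type indexes the
separate variables `h = (h₁, …, h_N) ∈ {0,1}^N`. -/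
abbrev Conf (N : ℕ) : Type := Fin N → Fin 2

/-- Linear operators on the quantum space `⊗ₙ ℂ²`, as matrices in the product `σᶻ`-basis. They act
on kets (column vectors) by `mulVec` and on bras (row vectors, i.e. elements of the dual space in
the dual basis) by `vecMul`; the value of a bra on a ket is their `dotProduct`. -/
abbrev Op (N : ℕ) : Type := Matrix (Conf N) (Conf N) ℂ

/-- The Pauli matrix `σᶻ`, with label `0` for spin down and `1` for spin up. -/
def pauliZ : Matrix (Fin 2) (Fin 2) ℂ := !![-1, 0; 0, 1]

/-- The raising matrix `σ⁺` (down ↦ up, up ↦ 0). -/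
def pauliPlus : Matrix (Fin 2) (Fin 2) ℂ := !![0, 0; 1, 0]

/-- The lowering matrix `σ⁻` (up ↦ down, down ↦ 0). -/
def pauliMinus : Matrix (Fin 2) (Fin 2) ℂ := !![0, 1; 0, 0]

/-- The operator `1 ⊗ ⋯ ⊗ X ⊗ ⋯ ⊗ 1` with `X` acting at site `n`. -/
def atSite {N : ℕ} (n : Fin N) (X : Matrix (Fin 2) (Fin 2) ℂ) : Op N :=
  Matrix.of fun s t => if ∀ m, m ≠ n → s m = t m then X (s n) (t n) else 0

/-- `x₊(u) = (u q - (q u)⁻¹ + u - u⁻¹) / 2`. -/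
def xPlus (q u : ℂ) : ℂ := (u * q - (q * u)⁻¹ + u - u⁻¹) / 2

/-- `x₋(u) = (u q - (q u)⁻¹ - u + u⁻¹) / 2`. -/
def xMinus (q u : ℂ) : ℂ := (u * q - (q * u)⁻¹ - u + u⁻¹) / 2

/-- The 6-vertex Lax operator at site `n`, as a `2 × 2` matrix over the auxiliary space whose
entries are operators on the chain. -/
def lax {N : ℕ} (q : ℂ) (n : Fin N) (u : ℂ) : Matrix (Fin 2) (Fin 2) (Op N) :=
  !![xPlus q u • (1 : Op N) + xMinus q u • atSite n pauliZ, (q - q⁻¹) • atSite n pauliMinus;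
     (q - q⁻¹) • atSite n pauliPlus, xPlus q u • (1 : Op N) - xMinus q u • atSite n pauliZ]

/-- The monodromy matrix `L_N(u / η_N) ⋯ L_1(u / η_1)`. -/
def monodromy {N : ℕ} (q : ℂ) (η : Fin N → ℂ) (u : ℂ) : Matrix (Fin 2) (Fin 2) (Op N) :=
  (List.ofFn fun n : Fin N => lax q n (u / η n)).reverse.prod

/-- The monodromy entry `B(u)` (upper right). -/
def opB {N : ℕ} (q : ℂ) (η : Fin N → ℂ) (u : ℂ) : Op N := monodromy q η u 0 1

/-- The monodromy entry `C(u)` (lower left). -/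
def opC {N : ℕ} (q : ℂ) (η : Fin N → ℂ) (u : ℂ) : Op N := monodromy q η u 1 0

/-- `a(u) = - ∏ₙ (u q / ηₙ - ηₙ / (u q))`. -/
def aFun {N : ℕ} (q : ℂ) (η : Fin N → ℂ) (u : ℂ) : ℂ :=
  - ∏ n, (u * q / η n - η n / (u * q))

/-- `d(u) = ∏ₙ (u / ηₙ - ηₙ / u)`. -/
def dFun {N : ℕ} (η : Fin N → ℂ) (u : ℂ) : ℂ := ∏ n, (u / η n - η n / u)

/-- Coordinates of the reference state (all spins up), both as a bra and as a ket. -/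
def refState (N : ℕ) : Conf N → ℂ := Pi.single (fun _ => 1) 1

/-- The left state `⟨h₁, …, h_N| = ν⁻¹ ⟨0| ∏ₙ (C(ηₙ) / d(ηₙ / q)) ^ hₙ`, where `ν` is the
normalization. -/
def bra {N : ℕ} (q : ℂ) (η : Fin N → ℂ) (ν : ℂ) (h : Conf N) : Conf N → ℂ :=
  ν⁻¹ • (refState N ᵥ*
    (List.ofFn fun n : Fin N => ((dFun η (η n / q))⁻¹ • opC q η (η n)) ^ (h n : ℕ)).prod)

/-- The right state `|h₁, …, h_N⟩ = ν⁻¹ ∏ₙ (B(ηₙ) / a(ηₙ)) ^ hₙ |0⟩`. -/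
def ket {N : ℕ} (q : ℂ) (η : Fin N → ℂ) (ν : ℂ) (h : Conf N) : Conf N → ℂ :=
  ν⁻¹ • ((List.ofFn fun n : Fin N => ((aFun q η (η n))⁻¹ • opB q η (η n)) ^ (h n : ℕ)).prod *ᵥ
    refState N)

/-- The matrix `U^{(L)}`: its row `h` holds the coordinates of `⟨h|` in the dual spin basis. -/
def matUL {N : ℕ} (q : ℂ) (η : Fin N → ℂ) (ν : ℂ) : Matrix (Conf N) (Conf N) ℂ :=
  Matrix.of fun h s => bra q η ν h s

/-- The matrix `U^{(R)}`: its column `h` holds the coordinates of `|h⟩` in the spin basis. -/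
def matUR {N : ℕ} (q : ℂ) (η : Fin N → ℂ) (ν : ℂ) : Matrix (Conf N) (Conf N) ℂ :=
  Matrix.of fun s h => ket q η ν h s

/-- The matrix `M = U^{(L)} U^{(R)}` of pairings. -/
def matM {N : ℕ} (q : ℂ) (η : Fin N → ℂ) (ν : ℂ) : Matrix (Conf N) (Conf N) ℂ :=
  matUL q η ν * matUR q η ν

/-- Sklyanin's measure `μ_h = 1 / ⟨h|h⟩`. -/
def sklyaninMeasure {N : ℕ} (q : ℂ) (η : Fin N → ℂ) (ν : ℂ) (h : Conf N) : ℂ :=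
  1 / (bra q η ν h ⬝ᵥ ket q η ν h)

/-- The operator `|h⟩⟨h|`. -/
def ketBra {N : ℕ} (q : ℂ) (η : Fin N → ℂ) (ν : ℂ) (h : Conf N) : Op N :=
  Matrix.vecMulVec (ket q η ν h) (bra q η ν h)

/-- `ω(x) = x ^ (N - 1)`. -/
def omega (N : ℕ) (x : ℂ) : ℂ := x ^ ((N : ℤ) - 1)

/-- The integer value in `{0, 1}` of the separate variable `h a`, for use in exponents. -/
def hInt {N : ℕ} (h : Conf N) (a : Fin N) : ℤ := ((h a : ℕ) : ℤ)

end XXZ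

end

namespace XXZ

open Matrix

/-! ### One-site operators on the chain -/

section Sites

variable {N : ℕ}

/-! Write `[x, y] = x/y - y/x`. The states `⟨h|` and `|h⟩` are left and right eigenvectors of `D(u)`
with the common eigenvalue `∏ₙ [u q^{hₙ}, ηₙ]` (`bra_vecMul_opD`, `opD_mulVec_ket`). Indeed the
reference state is one, and `C(η_a)` or `B(η_a)` raises `h_a` from 0 to 1: when `D(u)` is moved past
it, the unwanted term of the exchange relation has `D(η_a)` acting on a state with `h_a = 0`, where
the eigenvalue vanishes. At `u = η_a/q` the eigenvalue is zero exactly when `h_a = 1`, so states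
with different labels are orthogonal.

The norms follow from a recursion in one label, `norm_update`. The `D`–`C` relation at `η_a` and
`η_a/q` is sandwiched between `⟨h|` and the ket with `h_a` raised, and the quantum determinant
replaces `C(η_a/q) B(η_a)` by a scalar. The resulting ratio of eigenvalues is the ratio of the
products of pair factors for the two labels, and the recursion starts at `ν⁻²`.

Since `M` is diagonal with nonzero entries, it is invertible; reversing the order of the square
factors gives the resolution of the identity. Its second form is a Vandermonde rewriting of the
inverse norms. -/

lemma atSite_apply (n : Fin N) (X : Matrix (Fin 2) (Fin 2) ℂ) (s t : Conf N) :
    atSite n X s t = if ∀ m, m ≠ n → s m = t m then X (s n) (t n) else 0 := rfl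

lemma eq_update_of_agree {n : Fin N} {s t : Conf N} (h : ∀ m, m ≠ n → s m = t m) :
    t = Function.update s n (t n) := by
  funext m
  by_cases hm : m = n
  · subst hm; simp
  · simp [Function.update_of_ne hm, h m hm]

/-- Only intermediate configurations differing from `s` at `n` alone contribute, so the sum over
`2^N` terms collapses to two. -/
lemma atSite_mul_apply (n : Fin N) (X : Matrix (Fin 2) (Fin 2) ℂ) (M : Op N) (s t : Conf N) :
    (atSite n X * M) s t = ∑ x, X (s n) x * M (Function.update s n x) t := by
  rw [Matrix.mul_apply]
  symm
  refine Finset.sum_of_injOn (fun x => Function.update s n x) ?_ (by simp) ?_ ?_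
  · intro x _ y _ h
    simpa using congrFun h n
  · intro r _ hr
    rw [atSite_apply, if_neg, zero_mul]
    intro h
    exact hr ⟨r n, by simp, (eq_update_of_agree h).symm⟩
  · intro x _
    rw [atSite_apply, if_pos]
    · simp
    · intro m hm
      simp [Function.update_of_ne hm]

lemma atSite_mul (n : Fin N) (X Y : Matrix (Fin 2) (Fin 2) ℂ) :
    atSite n (X * Y) = atSite n X * atSite n Y := by
  ext s t
  rw [atSite_mul_apply, atSite_apply]
  have hcond : ∀ x, (∀ m, m ≠ n → Function.update s n x m = t m) ↔ ∀ m, m ≠ n → s m = t m := by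
    intro x
    refine forall₂_congr fun m hm => ?_
    rw [Function.update_of_ne hm]
  simp only [atSite_apply, hcond, Function.update_self]
  split_ifs <;> simp [Matrix.mul_apply]

lemma atSite_one (n : Fin N) : atSite n (1 : Matrix (Fin 2) (Fin 2) ℂ) = 1 := by
  ext s t
  rw [atSite_apply]
  by_cases hst : s = t
  · subst hst; simp
  · rw [Matrix.one_apply_ne hst]
    split_ifs with h
    · refine Matrix.one_apply_ne fun h' => hst ?_
      rw [eq_update_of_agree h, ← h', Function.update_eq_self]
    · rfl

/-- The embedding of the one-site operators at site `n`, as an algebra homomorphism. -/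
def atSiteHom (n : Fin N) : Matrix (Fin 2) (Fin 2) ℂ →ₐ[ℂ] Op N :=
  AlgHom.ofLinearMap
    { toFun := atSite n
      map_add' := fun X Y => by
        ext s t
        simp only [atSite_apply, Matrix.add_apply]
        split_ifs <;> simp
      map_smul' := fun c X => by
        ext s t
        simp only [atSite_apply, Matrix.smul_apply, RingHom.id_apply]
        split_ifs <;> simp }
    (atSite_one n) (atSite_mul n)

@[simp] lemma atSiteHom_apply (n : Fin N) (X : Matrix (Fin 2) (Fin 2) ℂ) :
    atSiteHom n X = atSite n X := rfl

lemma atSite_mul_atSite_apply {n m : Fin N} (hnm : n ≠ m) (X Y : Matrix (Fin 2) (Fin 2) ℂ)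
    (s t : Conf N) :
    (atSite n X * atSite m Y) s t =
      if ∀ k, k ≠ n → k ≠ m → s k = t k then X (s n) (t n) * Y (s m) (t m) else 0 := by
  rw [atSite_mul_apply]
  have key : ∀ x, X (s n) x * atSite m Y (Function.update s n x) t =
      if x = t n then
        (if ∀ k, k ≠ n → k ≠ m → s k = t k then X (s n) (t n) * Y (s m) (t m) else 0) else 0 := by
    intro x
    rw [atSite_apply, Function.update_of_ne hnm.symm]
    by_cases hx : x = t n
    · subst hx
      have : (∀ k, k ≠ m → Function.update s n (t n) k = t k) ↔
          ∀ k, k ≠ n → k ≠ m → s k = t k := by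
        constructor
        · intro h k hk hk'
          rw [← h k hk', Function.update_of_ne hk]
        · intro h k hk
          by_cases hkn : k = n
          · subst hkn; simp
          · rw [Function.update_of_ne hkn, h k hkn hk]
      simp only [this, if_true]
      split_ifs <;> simp
    · rw [if_neg, if_neg hx, mul_zero]
      intro h
      exact hx (by simpa using h n hnm)
  simp [key]

lemma atSite_commute {n m : Fin N} (hnm : n ≠ m) (X Y : Matrix (Fin 2) (Fin 2) ℂ) :
    Commute (atSite n X) (atSite m Y) := by
  ext s t
  rw [atSite_mul_atSite_apply hnm, atSite_mul_atSite_apply hnm.symm]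
  have : (∀ k, k ≠ n → k ≠ m → s k = t k) ↔ ∀ k, k ≠ m → k ≠ n → s k = t k :=
    forall_congr' fun k => by tauto
  simp only [this, mul_comm]

end Sites

/-! ### Exchange relations and quantum determinant, abstractly -/

section Relations

variable {R : Type*} [Ring R] [Algebra ℂ R]

/-- The exchange relations `R₁₂ X₁ Y₂ = Y₂ X₁ R₁₂` in components, for the six-vertex `R`-matrix
with weights `a`, `b`, `c`. -/
def RTT (a b c : ℂ) (X Y : Matrix (Fin 2) (Fin 2) R) : Prop :=
  ∀ i j k l,
    (if i = j then a else b) • (X i k * Y j l) + (if i = j then 0 else c) • (X j k * Y i l) =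
      (if k = l then a else b) • (Y j l * X i k) + (if k = l then 0 else c) • (Y j k * X i l)

/-- The coproduct property: by ultralocality the product of the two monodromies regroups into a
product of pairs, and the `R`-matrix is pulled through one pair after the other. -/
lemma RTT.mul {a b c : ℂ} {X Y X' Y' : Matrix (Fin 2) (Fin 2) R} (h : RTT a b c X Y)
    (h' : RTT a b c X' Y') (hXY : ∀ i j k l, Commute (X i j) (Y' k l))
    (hYX : ∀ i j k l, Commute (Y i j) (X' k l)) : RTT a b c (X * X') (Y * Y') := by
  have e₁ : ∀ i j k l, (X * X') i k * (Y * Y') j l =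
      ∑ m, ∑ n, (X i m * Y j n) * (X' m k * Y' n l) := by
    intro i j k l
    simp only [Matrix.mul_apply, Finset.sum_mul_sum]
    refine Finset.sum_congr rfl fun m _ => Finset.sum_congr rfl fun n _ => ?_
    rw [mul_assoc, ← mul_assoc (X' m k), ← (hYX j n m k).eq, mul_assoc, mul_assoc]
  have e₂ : ∀ i j k l, (Y * Y') j l * (X * X') i k =
      ∑ m, ∑ n, (Y j n * X i m) * (Y' n l * X' m k) := by
    intro i j k l
    simp only [Matrix.mul_apply, Finset.sum_mul_sum]
    rw [Finset.sum_comm]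
    refine Finset.sum_congr rfl fun m _ => Finset.sum_congr rfl fun n _ => ?_
    rw [mul_assoc, ← mul_assoc (Y' n l), ← (hXY i m n l).eq, mul_assoc, mul_assoc]
  intro i j k l
  rw [e₁ i j k l, e₁ j i k l, e₂ i j k l, e₂ i j l k]
  -- Exchanging the two summed auxiliary indices transfers the off-diagonal part of `R` from the
  -- first pair to the second.
  have swap : ∑ m, ∑ n, ((if m = n then (0 : ℂ) else c) • (Y j m * X i n)) * (X' m k * Y' n l) =
      ∑ m, ∑ n, (Y j n * X i m) * ((if m = n then (0 : ℂ) else c) • (X' n k * Y' m l)) := by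
    rw [Finset.sum_comm]
    refine Finset.sum_congr rfl fun m _ => Finset.sum_congr rfl fun n _ => ?_
    simp only [smul_mul_assoc, mul_smul_comm, eq_comm]
  simp only [smul_mul_assoc, mul_smul_comm] at swap
  calc _ = ∑ m, ∑ n, ((if i = j then a else b) • (X i m * Y j n) +
        (if i = j then 0 else c) • (X j m * Y i n)) * (X' m k * Y' n l) := by
        simp only [Finset.smul_sum, add_mul, smul_mul_assoc, Finset.sum_add_distrib]
    _ = ∑ m, ∑ n, ((if m = n then a else b) • (Y j n * X i m) +
        (if m = n then 0 else c) • (Y j m * X i n)) * (X' m k * Y' n l) :=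
        Finset.sum_congr rfl fun m _ => Finset.sum_congr rfl fun n _ => by rw [h i j m n]
    _ = ∑ m, ∑ n, (Y j n * X i m) * ((if m = n then a else b) • (X' m k * Y' n l) +
        (if m = n then 0 else c) • (X' n k * Y' m l)) := by
        simp only [add_mul, mul_add, Finset.sum_add_distrib, swap, smul_mul_assoc, mul_smul_comm]
    _ = ∑ m, ∑ n, (Y j n * X i m) * ((if k = l then a else b) • (Y' n l * X' m k) +
        (if k = l then 0 else c) • (Y' n k * X' m l)) :=
        Finset.sum_congr rfl fun m _ => Finset.sum_congr rfl fun n _ => by rw [h' m n k l]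
    _ = _ := by
        simp only [Finset.smul_sum, mul_add, mul_smul_comm, Finset.sum_add_distrib]

lemma RTT.one (a b c : ℂ) : RTT a b c (1 : Matrix (Fin 2) (Fin 2) R) 1 := by
  intro i j k l
  fin_cases i <;> fin_cases j <;> fin_cases k <;> fin_cases l <;> simp

lemma RTT.map {S : Type*} [Ring S] [Algebra ℂ S] {a b c : ℂ} {X Y : Matrix (Fin 2) (Fin 2) R}
    (h : RTT a b c X Y) (f : R →ₐ[ℂ] S) : RTT a b c (X.map f) (Y.map f) := by
  intro i j k l
  simpa only [map_add, map_smul, map_mul, Matrix.map_apply] using congrArg f (h i j k l)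

/-- The antisymmetrized product of `S` and `T` is `δ` times the antisymmetrizer; for a monodromy
matrix at shifted arguments `δ` is the quantum determinant. -/
def QDet (δ : ℂ) (S T : Matrix (Fin 2) (Fin 2) R) : Prop :=
  ∀ k l, S 0 k * T 1 l - S 1 k * T 0 l =
    (if k = 0 then (if l = 0 then 0 else δ) else if l = 0 then -δ else 0) • (1 : R)

lemma QDet.mul {δ δ' : ℂ} {S T S' T' : Matrix (Fin 2) (Fin 2) R} (h : QDet δ S T)
    (h' : QDet δ' S' T') (hTS : ∀ i j k l, Commute (T i j) (S' k l)) :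
    QDet (δ * δ') (S * S') (T * T') := by
  have e : ∀ i j k l, (S * S') i k * (T * T') j l =
      ∑ m, ∑ n, (S i m * T j n) * (S' m k * T' n l) := by
    intro i j k l
    simp only [Matrix.mul_apply, Finset.sum_mul_sum]
    refine Finset.sum_congr rfl fun m _ => Finset.sum_congr rfl fun n _ => ?_
    rw [mul_assoc, ← mul_assoc (S' m k), ← (hTS j n m k).eq, mul_assoc, mul_assoc]
  intro k l
  rw [e, e]
  calc _ = ∑ m, ∑ n, (S 0 m * T 1 n - S 1 m * T 0 n) * (S' m k * T' n l) := by
        simp only [sub_mul, Finset.sum_sub_distrib]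
    _ = δ • (S' 0 k * T' 1 l - S' 1 k * T' 0 l) := by
        simp only [h _ _, Fin.sum_univ_two]
        simp [sub_eq_add_neg]
    _ = _ := by
        rw [h' k l, smul_smul]
        split_ifs <;> simp

lemma QDet.one : QDet 1 (1 : Matrix (Fin 2) (Fin 2) R) 1 := by
  intro k l
  fin_cases k <;> fin_cases l <;> simp [Matrix.one_apply]

lemma QDet.map {S : Type*} [Ring S] [Algebra ℂ S] {δ : ℂ} {X Y : Matrix (Fin 2) (Fin 2) R}
    (h : QDet δ X Y) (f : R →ₐ[ℂ] S) : QDet δ (X.map f) (Y.map f) := by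
  intro k l
  simpa only [map_sub, map_smul, map_mul, map_one, Matrix.map_apply] using congrArg f (h k l)

end Relations

/-! ### The six-vertex Lax operator at one site -/

section Lax

/-- The antisymmetric bracket `x / y - y / x`. -/
noncomputable def bracket (x y : ℂ) : ℂ := x / y - y / x

/-- The Lax operator of a single site. -/
noncomputable def localLax (q u : ℂ) : Matrix (Fin 2) (Fin 2) (Matrix (Fin 2) (Fin 2) ℂ) :=
  !![!![u - u⁻¹, 0; 0, u * q - (q * u)⁻¹], !![0, q - q⁻¹; 0, 0];
     !![0, 0; q - q⁻¹, 0], !![u * q - (q * u)⁻¹, 0; 0, u - u⁻¹]]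

/-- Reduces the relations for `lax` to finite checks on two-by-two matrices, transported along
`atSiteHom`. -/
lemma lax_eq_map {N : ℕ} (q : ℂ) (n : Fin N) (u : ℂ) :
    lax q n u = (localLax q u).map (atSiteHom n) := by
  have h₀ : localLax q u 0 0 = xPlus q u • 1 + xMinus q u • pauliZ := by
    ext s t
    fin_cases s <;> fin_cases t <;> simp [localLax, xPlus, xMinus, pauliZ] <;> ring
  have h₁ : localLax q u 0 1 = (q - q⁻¹) • pauliMinus := by
    ext s t
    fin_cases s <;> fin_cases t <;> simp [localLax, pauliMinus]
  have h₂ : localLax q u 1 0 = (q - q⁻¹) • pauliPlus := by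
    ext s t
    fin_cases s <;> fin_cases t <;> simp [localLax, pauliPlus]
  have h₃ : localLax q u 1 1 = xPlus q u • 1 - xMinus q u • pauliZ := by
    ext s t
    fin_cases s <;> fin_cases t <;> simp [localLax, xPlus, xMinus, pauliZ] <;> ring
  apply Matrix.ext
  intro i j
  rw [Matrix.map_apply]
  fin_cases i <;> fin_cases j
  · simp only [Fin.zero_eta, h₀, map_add, map_smul, map_one]; rfl
  · simp only [Fin.zero_eta, Fin.mk_one, h₁, map_smul]; rfl
  · simp only [Fin.zero_eta, Fin.mk_one, h₂, map_smul]; rfl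
  · simp only [Fin.mk_one, h₃, map_sub, map_smul, map_one]; rfl

lemma localLax_rtt {q u v : ℂ} (hq : q ≠ 0) (hu : u ≠ 0) (hv : v ≠ 0) :
    RTT (bracket (u * q) v) (bracket u v) (q - q⁻¹) (localLax q u) (localLax q v) := by
  intro i j k l
  ext s t
  fin_cases i <;> fin_cases j <;> fin_cases k <;> fin_cases l <;> fin_cases s <;> fin_cases t <;>
    (simp [localLax, bracket]; try (field_simp; try ring_nf; try simp))

lemma localLax_qdet {q u : ℂ} (hq : q ≠ 0) (hu : u ≠ 0) :
    QDet (bracket (u * q) 1 * bracket (u / q) 1) (localLax q (u / q)) (localLax q u) := by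
  intro k l
  ext s t
  fin_cases k <;> fin_cases l <;> fin_cases s <;> fin_cases t <;>
    simp [localLax, bracket] <;> field_simp <;> ring

end Lax

/-! ### Relations for the monodromy matrix -/

section Monodromy

variable {N : ℕ} {q : ℂ} {η : Fin N → ℂ}

/-- The ordered product of the Lax operators over a list of sites. -/
noncomputable def chain (q : ℂ) (η : Fin N → ℂ) (u : ℂ) (l : List (Fin N)) :
    Matrix (Fin 2) (Fin 2) (Op N) :=
  (l.map fun n => lax q n (u / η n)).prod

lemma chain_nil (u : ℂ) : chain q η u [] = 1 := rfl

lemma chain_cons (u : ℂ) (n : Fin N) (l : List (Fin N)) :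
    chain q η u (n :: l) = lax q n (u / η n) * chain q η u l := by
  simp [chain]

lemma monodromy_eq_chain (u : ℂ) :
    monodromy q η u = chain q η u (List.finRange N).reverse := by
  rw [monodromy, chain, List.ofFn_eq_map, List.map_reverse]

lemma nodup_reverse_finRange : (List.finRange N).reverse.Nodup :=
  List.nodup_reverse.2 (List.nodup_finRange N)

lemma atSite_commute_chain {n : Fin N} {l : List (Fin N)} (hn : n ∉ l)
    (X : Matrix (Fin 2) (Fin 2) ℂ) (u : ℂ) (i j : Fin 2) :
    Commute (atSite n X) (chain q η u l i j) := by
  induction l generalizing i j with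
  | nil =>
    rw [chain_nil, Matrix.one_apply]
    split_ifs
    · exact Commute.one_right _
    · exact Commute.zero_right _
  | cons m l ih =>
    rw [List.mem_cons, not_or] at hn
    rw [chain_cons, Matrix.mul_apply]
    refine Commute.sum_right _ _ _ fun k _ => Commute.mul_right ?_ (ih hn.2 k j)
    rw [lax_eq_map]
    exact atSite_commute hn.1 _ _

lemma lax_commute_chain {n : Fin N} {l : List (Fin N)} (hn : n ∉ l) (v u : ℂ) (i j k m : Fin 2) :
    Commute (lax q n v i j) (chain q η u l k m) := by
  rw [lax_eq_map]
  exact atSite_commute_chain hn _ u k m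

lemma bracket_div {x u v : ℂ} (hx : x ≠ 0) : bracket (u / x) (v / x) = bracket u v := by
  unfold bracket
  rw [div_div_div_cancel_right₀ hx, div_div_div_cancel_right₀ hx]

lemma chain_rtt (hq : q ≠ 0) (hη : ∀ n, η n ≠ 0) {u v : ℂ} (hu : u ≠ 0) (hv : v ≠ 0)
    {l : List (Fin N)} (hl : l.Nodup) :
    RTT (bracket (u * q) v) (bracket u v) (q - q⁻¹) (chain q η u l) (chain q η v l) := by
  induction l with
  | nil => exact RTT.one _ _ _
  | cons n l ih =>
    rw [List.nodup_cons] at hl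
    rw [chain_cons, chain_cons]
    refine RTT.mul ?_ (ih hl.2) (fun i j k m => lax_commute_chain hl.1 _ _ i j k m)
      (fun i j k m => lax_commute_chain hl.1 _ _ i j k m)
    have := localLax_rtt hq (div_ne_zero hu (hη n)) (div_ne_zero hv (hη n))
    rw [div_mul_eq_mul_div, bracket_div (hη n), bracket_div (hη n)] at this
    simpa only [lax_eq_map] using this.map (atSiteHom n)

lemma chain_qdet (hq : q ≠ 0) (hη : ∀ n, η n ≠ 0) {u : ℂ} (hu : u ≠ 0)
    {l : List (Fin N)} (hl : l.Nodup) :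
    QDet ((l.map fun n => bracket (u * q) (η n) * bracket (u / q) (η n)).prod)
      (chain q η (u / q) l) (chain q η u l) := by
  induction l with
  | nil => exact QDet.one
  | cons n l ih =>
    rw [List.nodup_cons] at hl
    rw [chain_cons, chain_cons, List.map_cons, List.prod_cons]
    refine QDet.mul ?_ (ih hl.2) (fun i j k m => lax_commute_chain hl.1 _ _ i j k m)
    have := localLax_qdet hq (div_ne_zero hu (hη n))
    have e : ∀ x, bracket (x / η n) 1 = bracket x (η n) := fun x => by
      rw [← bracket_div (hη n) (u := x) (v := η n), div_self (hη n)]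
    rw [div_mul_eq_mul_div, div_right_comm, e, e] at this
    simpa only [lax_eq_map] using this.map (atSiteHom n)

/-- The monodromy entry `D(u)` (lower right). -/
noncomputable def opD (q : ℂ) (η : Fin N → ℂ) (u : ℂ) : Op N := monodromy q η u 1 1

lemma monodromy_rtt (hq : q ≠ 0) (hη : ∀ n, η n ≠ 0) {u v : ℂ} (hu : u ≠ 0) (hv : v ≠ 0) :
    RTT (bracket (u * q) v) (bracket u v) (q - q⁻¹) (monodromy q η u) (monodromy q η v) := by
  simpa only [monodromy_eq_chain] using chain_rtt hq hη hu hv nodup_reverse_finRange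

lemma opB_commute (hq : q ≠ 0) (hη : ∀ n, η n ≠ 0) {u v : ℂ} (hu : u ≠ 0) (hv : v ≠ 0)
    (huv : bracket (u * q) v ≠ 0) : Commute (opB q η u) (opB q η v) := by
  have := monodromy_rtt hq hη hu hv 0 0 1 1
  simp only [if_true, zero_smul, add_zero] at this
  exact smul_right_injective _ huv this

lemma opC_commute (hq : q ≠ 0) (hη : ∀ n, η n ≠ 0) {u v : ℂ} (hu : u ≠ 0) (hv : v ≠ 0)
    (huv : bracket (u * q) v ≠ 0) : Commute (opC q η u) (opC q η v) := by
  have := monodromy_rtt hq hη hu hv 1 1 0 0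
  simp only [if_true, zero_smul, add_zero] at this
  exact smul_right_injective _ huv this

lemma opD_mul_opC (hq : q ≠ 0) (hη : ∀ n, η n ≠ 0) {u v : ℂ} (hu : u ≠ 0) (hv : v ≠ 0) :
    bracket (u * q) v • (opD q η u * opC q η v) =
      bracket u v • (opC q η v * opD q η u) + (q - q⁻¹) • (opD q η v * opC q η u) := by
  simpa [opC, opD] using monodromy_rtt hq hη hu hv 1 1 1 0

lemma opD_mul_opB (hq : q ≠ 0) (hη : ∀ n, η n ≠ 0) {u v : ℂ} (hu : u ≠ 0) (hv : v ≠ 0) :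
    bracket u v • (opD q η u * opB q η v) + (q - q⁻¹) • (opB q η u * opD q η v) =
      bracket (u * q) v • (opB q η v * opD q η u) := by
  simpa [opB, opD] using monodromy_rtt hq hη hu hv 1 0 1 1

lemma aFun_eq (u : ℂ) : aFun q η u = -∏ n, bracket (u * q) (η n) := rfl

lemma dFun_eq (u : ℂ) : dFun η u = ∏ n, bracket u (η n) := rfl

lemma monodromy_qdet (hq : q ≠ 0) (hη : ∀ n, η n ≠ 0) {u : ℂ} (hu : u ≠ 0) :
    monodromy q η (u / q) 0 0 * opD q η u - opC q η (u / q) * opB q η u =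
      (-(aFun q η u * dFun η (u / q))) • (1 : Op N) := by
  have := chain_qdet hq hη hu (nodup_reverse_finRange (N := N)) 0 1
  simp only [← monodromy_eq_chain] at this
  rw [opD, opC, opB, this, aFun_eq, dFun_eq, neg_mul, neg_neg, ← Finset.prod_mul_distrib]
  congr 1
  rw [List.map_reverse, List.prod_reverse, ← List.ofFn_eq_map, List.prod_ofFn]
  simp

end Monodromy

/-! ### The reference state as an eigenvector of `D` -/

section Vacuum

variable {N : ℕ} {q : ℂ} {η : Fin N → ℂ}

lemma atSite_mulVec_refState (n : Fin N) {X : Matrix (Fin 2) (Fin 2) ℂ} (hX : X 0 1 = 0) :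
    atSite n X *ᵥ refState N = X 1 1 • refState N := by
  funext s
  rw [refState, Matrix.mulVec_single_one, Pi.smul_apply, Matrix.col_apply, atSite_apply,
    Pi.single_apply]
  by_cases hs : s = fun _ => 1
  · subst hs; simp
  · rw [if_neg hs, smul_zero]
    split_ifs with h
    · obtain h0 | h1 : s n = 0 ∨ s n = 1 := by
        generalize s n = x
        fin_cases x <;> simp
      · rw [h0, hX]
      · refine absurd (funext fun m => ?_) hs
        by_cases hm : m = n
        · rw [hm, h1]
        · exact h m hm
    · rfl

lemma refState_vecMul_atSite (n : Fin N) {X : Matrix (Fin 2) (Fin 2) ℂ} (hX : X 1 0 = 0) :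
    refState N ᵥ* atSite n X = X 1 1 • refState N := by
  have h : (atSite n X)ᵀ = atSite n Xᵀ := by
    ext s t
    simp only [Matrix.transpose_apply, atSite_apply, eq_comm]
  rw [← Matrix.mulVec_transpose, h]
  exact atSite_mulVec_refState n hX

lemma bracket_one (u : ℂ) : bracket u 1 = u - u⁻¹ := by simp [bracket]

lemma opD_mulVec_refState (u : ℂ) :
    opD q η u *ᵥ refState N = dFun η u • refState N := by
  have key : ∀ l : List (Fin N), l.Nodup →
      chain q η u l 1 1 *ᵥ refState N =
        (l.map fun n => bracket u (η n)).prod • refState N := by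
    intro l hl
    induction l with
    | nil => simp [chain_nil]
    | cons n l ih =>
      rw [List.nodup_cons] at hl
      have h₁ : lax q n (u / η n) 1 0 *ᵥ refState N = 0 := by
        rw [lax_eq_map]
        refine (atSite_mulVec_refState n ?_).trans ?_ <;> simp [localLax]
      have h₂ : lax q n (u / η n) 1 1 *ᵥ refState N = bracket u (η n) • refState N := by
        rw [lax_eq_map]
        refine (atSite_mulVec_refState n ?_).trans ?_ <;> simp [localLax, bracket]
      -- The off-diagonal term is reordered so that the raising matrix meets the reference ket first
      -- and kills it.
      rw [chain_cons, Matrix.mul_apply, Fin.sum_univ_two,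
        (lax_commute_chain hl.1 _ u 1 0 0 1).eq, Matrix.add_mulVec, ← Matrix.mulVec_mulVec,
        ← Matrix.mulVec_mulVec, h₁, ih hl.2, Matrix.mulVec_zero, zero_add, Matrix.mulVec_smul, h₂,
        smul_smul, List.map_cons, List.prod_cons, mul_comm]
  rw [opD, monodromy_eq_chain, key _ nodup_reverse_finRange, List.map_reverse, List.prod_reverse,
    ← List.ofFn_eq_map, List.prod_ofFn, dFun_eq]

lemma refState_vecMul_opD (u : ℂ) :
    refState N ᵥ* opD q η u = dFun η u • refState N := by
  -- The raising matrix does not annihilate the reference bra, so the induction must also carry the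
  -- vanishing of the `B` entry.
  have key : ∀ l : List (Fin N), l.Nodup →
      refState N ᵥ* chain q η u l 0 1 = 0 ∧
      refState N ᵥ* chain q η u l 1 1 =
        (l.map fun n => bracket u (η n)).prod • refState N := by
    intro l hl
    induction l with
    | nil => simp [chain_nil]
    | cons n l ih =>
      rw [List.nodup_cons] at hl
      obtain ⟨ih₀, ih₁⟩ := ih hl.2
      have h₀ : refState N ᵥ* lax q n (u / η n) 0 1 = 0 := by
        rw [lax_eq_map]
        refine (refState_vecMul_atSite n ?_).trans ?_ <;> simp [localLax]
      have h₂ : refState N ᵥ* lax q n (u / η n) 1 1 = bracket u (η n) • refState N := by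
        rw [lax_eq_map]
        refine (refState_vecMul_atSite n ?_).trans ?_ <;> simp [localLax, bracket]
      simp only [chain_cons, Matrix.mul_apply, Fin.sum_univ_two]
      constructor
      · rw [(lax_commute_chain hl.1 _ u 0 0 0 1).eq, Matrix.vecMul_add, ← Matrix.vecMul_vecMul,
          ← Matrix.vecMul_vecMul, ih₀, h₀, Matrix.zero_vecMul, Matrix.zero_vecMul, zero_add]
      · rw [(lax_commute_chain hl.1 _ u 1 0 0 1).eq, Matrix.vecMul_add, ← Matrix.vecMul_vecMul,
          ← Matrix.vecMul_vecMul, ih₀, h₂, Matrix.zero_vecMul, zero_add, Matrix.smul_vecMul, ih₁,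
          smul_smul, List.map_cons, List.prod_cons]
  rw [opD, monodromy_eq_chain, (key _ nodup_reverse_finRange).2, List.map_reverse,
    List.prod_reverse, ← List.ofFn_eq_map, List.prod_ofFn, dFun_eq]

end Vacuum

/-! ### Nonvanishing consequences of genericity -/

section Genericity

variable {N : ℕ} {q : ℂ} {η : Fin N → ℂ}

lemma bracket_self (x : ℂ) : bracket x x = 0 := sub_self _

lemma bracket_swap (x y : ℂ) : bracket y x = -bracket x y := (neg_sub _ _).symm

lemma bracket_ne_zero {x y : ℂ} (hx : x ≠ 0) (hy : y ≠ 0) (h : x ^ 2 ≠ y ^ 2) :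
    bracket x y ≠ 0 := by
  intro h0
  unfold bracket at h0
  field_simp at h0
  exact h (by linear_combination h0)

lemma bracket_mul_left (c x y : ℂ) :
    bracket (x * c) y = bracket x (y / c) := by
  unfold bracket
  rw [div_div_eq_mul_div, div_div, mul_comm c x]

/-- The genericity assumptions on the anisotropy and the inhomogeneities, with the conditions on
pairs of sites in symmetric form. -/
structure Generic (q : ℂ) (η : Fin N → ℂ) : Prop where
  q_ne : q ≠ 0
  q_sq_ne : q ^ 2 ≠ 1
  eta_ne : ∀ n, η n ≠ 0
  bracket_ne : ∀ a b, a ≠ b → ∀ j : ℤ, j = -1 ∨ j = 0 ∨ j = 1 → bracket (η a * q ^ j) (η b) ≠ 0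

lemma Generic.of_lt (hq : q ≠ 0) (hq2 : q ^ 2 ≠ 1) (hη : ∀ n, η n ≠ 0)
    (hsov : ∀ a b : Fin N, b < a → ∀ j ∈ ({-1, 0, 1} : Set ℤ),
      η a ^ 2 ≠ q ^ (2 * j) * η b ^ 2) : Generic q η := by
  refine ⟨hq, hq2, hη, fun a b hab j hj => ?_⟩
  refine bracket_ne_zero (mul_ne_zero (hη a) (zpow_ne_zero _ hq)) (hη b) fun h => ?_
  have hsq : ∀ k : ℤ, (q ^ k) ^ 2 = q ^ (2 * k) := fun k => by
    rw [mul_comm, _root_.zpow_mul]; rfl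
  rw [mul_pow, hsq] at h
  -- The assumption is one-sided in the pair, but `{-1, 0, 1}` is stable under negation, which
  -- covers both orders.
  rcases lt_or_gt_of_ne hab with hlt | hlt
  · refine hsov b a hlt j ?_ ?_
    · simpa using hj
    · rw [← h, mul_comm]
  · refine hsov a b hlt (-j) ?_ ?_
    · simp only [Set.mem_insert_iff, Set.mem_singleton_iff]; omega
    · rw [← h, mul_neg, _root_.zpow_neg]
      have := zpow_ne_zero (2 * j) hq
      field_simp

lemma Generic.bracket_eta_ne (G : Generic q η) {a b : Fin N} (hab : a ≠ b) :
    bracket (η a) (η b) ≠ 0 := by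
  simpa using G.bracket_ne a b hab 0 (by simp)

lemma Generic.bracket_mul_ne (G : Generic q η) (a b : Fin N) :
    bracket (η a * q) (η b) ≠ 0 := by
  by_cases hab : a = b
  · subst hab
    refine bracket_ne_zero (mul_ne_zero (G.eta_ne a) G.q_ne) (G.eta_ne a) fun h => G.q_sq_ne ?_
    have := G.eta_ne a
    exact mul_left_cancel₀ (pow_ne_zero 2 this) (by rw [← mul_pow, h, mul_one])
  · simpa using G.bracket_ne a b hab 1 (by simp)

lemma Generic.bracket_div_ne (G : Generic q η) (a b : Fin N) :
    bracket (η a / q) (η b) ≠ 0 := by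
  rw [div_eq_mul_inv, bracket_mul_left, div_inv_eq_mul, bracket_swap]
  exact neg_ne_zero.2 (G.bracket_mul_ne b a)

lemma Generic.aFun_ne (G : Generic q η) (a : Fin N) : aFun q η (η a) ≠ 0 := by
  rw [aFun_eq]
  exact neg_ne_zero.2 (Finset.prod_ne_zero_iff.2 fun n _ => G.bracket_mul_ne a n)

lemma Generic.dFun_ne (G : Generic q η) (a : Fin N) : dFun η (η a / q) ≠ 0 := by
  rw [dFun_eq]
  exact Finset.prod_ne_zero_iff.2 fun n _ => G.bracket_div_ne a n

lemma Generic.q_sub_ne (G : Generic q η) : q - q⁻¹ ≠ 0 := by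
  rw [← bracket_one]
  exact bracket_ne_zero G.q_ne one_ne_zero (by simpa using G.q_sq_ne)

end Genericity

/-! ### Raising one label at a time -/

section Configurations

variable {N : ℕ}

lemma eq_zero_or_eq_one (x : Fin 2) : x = 0 ∨ x = 1 := by
  fin_cases x <;> simp

/-- Induction on configurations by raising one label at a time. -/
lemma conf_induction {p : Conf N → Prop} (zero : p fun _ => 0)
    (step : ∀ h a, h a = 0 → p h → p (Function.update h a 1)) (h : Conf N) : p h := by
  have key : ∀ s : Finset (Fin N), p fun n => if n ∈ s then 1 else 0 := by
    intro s
    induction s using Finset.induction_on with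
    | empty => simpa using zero
    | insert a s ha ih =>
      convert step _ a (by simp [ha]) ih using 1
      funext n
      by_cases hn : n = a
      · subst hn; simp
      · simp [hn]
  convert key (Finset.univ.filter fun n => h n = 1) using 1
  funext n
  rcases eq_zero_or_eq_one (h n) with hn | hn <;> simp [hn]

lemma prod_ofFn_pow_update {R : Type*} [Monoid R] {g : Fin N → R}
    (hg : ∀ a b, Commute (g a) (g b)) {h : Conf N} {a : Fin N} (ha : h a = 0) :
    (List.ofFn fun n => g n ^ (Function.update h a 1 n : ℕ)).prod =
      g a * (List.ofFn fun n => g n ^ (h n : ℕ)).prod := by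
  have key : ∀ l : List (Fin N), l.Nodup →
      (l.map fun n => g n ^ (Function.update h a 1 n : ℕ)).prod =
        (if a ∈ l then g a else 1) * (l.map fun n => g n ^ (h n : ℕ)).prod := by
    intro l hl
    induction l with
    | nil => simp
    | cons n l ih =>
      rw [List.nodup_cons] at hl
      rw [List.map_cons, List.prod_cons, List.map_cons, List.prod_cons, ih hl.2]
      by_cases hn : n = a
      · subst hn
        simp [hl.1, ha]
      · rw [Function.update_of_ne hn, ← mul_assoc, ← mul_assoc]
        congr 1
        have : a ≠ n := fun h => hn h.symm
        simp only [List.mem_cons, this, false_or]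
        split_ifs
        · exact (hg n a).pow_left _
        · simp
  rw [List.ofFn_eq_map, List.ofFn_eq_map, key _ (List.nodup_finRange N)]
  simp

end Configurations

/-! ### The states as eigenvectors of `D` -/

section States

variable {N : ℕ} {q : ℂ} {η : Fin N → ℂ} {ν : ℂ}

lemma bra_zero : bra q η ν (fun _ => 0) = ν⁻¹ • refState N := by
  simp [bra]

lemma ket_zero : ket q η ν (fun _ => 0) = ν⁻¹ • refState N := by
  simp [ket]

lemma bra_update (G : Generic q η) {h : Conf N} {a : Fin N} (ha : h a = 0) :
    bra q η ν (Function.update h a 1) =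
      (dFun η (η a / q))⁻¹ • (bra q η ν h ᵥ* opC q η (η a)) := by
  have hc : ∀ a b, Commute ((dFun η (η a / q))⁻¹ • opC q η (η a))
      ((dFun η (η b / q))⁻¹ • opC q η (η b)) := fun a b =>
    ((opC_commute G.q_ne G.eta_ne (G.eta_ne a) (G.eta_ne b)
      (G.bracket_mul_ne a b)).smul_left _).smul_right _
  have hp := Commute.list_prod_right (y := (dFun η (η a / q))⁻¹ • opC q η (η a))
    (List.ofFn fun n => ((dFun η (η n / q))⁻¹ • opC q η (η n)) ^ (h n : ℕ)) (by
      simp only [List.forall_mem_ofFn_iff]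
      exact fun n => (hc a n).pow_right _)
  rw [bra, prod_ofFn_pow_update hc ha, hp.eq, ← Matrix.vecMul_vecMul, Matrix.vecMul_smul, bra,
    Matrix.smul_vecMul, smul_comm]

lemma ket_update (G : Generic q η) {h : Conf N} {a : Fin N} (ha : h a = 0) :
    ket q η ν (Function.update h a 1) =
      (aFun q η (η a))⁻¹ • (opB q η (η a) *ᵥ ket q η ν h) := by
  have hc : ∀ a b, Commute ((aFun q η (η a))⁻¹ • opB q η (η a))
      ((aFun q η (η b))⁻¹ • opB q η (η b)) := fun a b =>
    ((opB_commute G.q_ne G.eta_ne (G.eta_ne a) (G.eta_ne b)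
      (G.bracket_mul_ne a b)).smul_left _).smul_right _
  rw [ket, prod_ofFn_pow_update hc ha, ← Matrix.mulVec_mulVec, Matrix.smul_mulVec, ket,
    Matrix.mulVec_smul, smul_comm]

/-- The eigenvalue of `D(u)` on the states labelled by `h`. -/
noncomputable def eigD (q : ℂ) (η : Fin N → ℂ) (h : Conf N) (u : ℂ) : ℂ :=
  ∏ n, bracket (u * q ^ (h n : ℕ)) (η n)

lemma eigD_zero (u : ℂ) : eigD q η (fun _ => 0) u = dFun η u := by
  simp [eigD, dFun_eq]

/-- Stated without division because `bracket u (η a)` may vanish; both sides are the coefficients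
produced by the exchange relations. -/
lemma eigD_update {h : Conf N} {a : Fin N} (ha : h a = 0) (u : ℂ) :
    bracket u (η a) * eigD q η (Function.update h a 1) u =
      bracket (u * q) (η a) * eigD q η h u := by
  rw [eigD, eigD, ← Finset.mul_prod_erase _ _ (Finset.mem_univ a),
    ← Finset.mul_prod_erase Finset.univ (fun n => bracket (u * q ^ (h n : ℕ)) (η n))
      (Finset.mem_univ a), Function.update_self, ha]
  have : ∏ n ∈ Finset.univ.erase a, bracket (u * q ^ (Function.update h a 1 n : ℕ)) (η n) =
      ∏ n ∈ Finset.univ.erase a, bracket (u * q ^ (h n : ℕ)) (η n) :=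
    Finset.prod_congr rfl fun n hn => by rw [Function.update_of_ne (Finset.ne_of_mem_erase hn)]
  rw [this]
  simp only [Fin.val_one, Fin.val_zero, pow_one, pow_zero, mul_one]
  ring

lemma eigD_eta {h : Conf N} {a : Fin N} (ha : h a = 0) : eigD q η h (η a) = 0 :=
  Finset.prod_eq_zero (Finset.mem_univ a) (by simp [ha, bracket_self])

lemma eigD_eta_div (hq : q ≠ 0) {h : Conf N} {a : Fin N} (ha : h a = 1) :
    eigD q η h (η a / q) = 0 :=
  Finset.prod_eq_zero (Finset.mem_univ a) (by simp [ha, hq, bracket_self])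

lemma Generic.eigD_eta_div_ne (G : Generic q η) {h : Conf N} {a : Fin N} (ha : h a = 0) :
    eigD q η h (η a / q) ≠ 0 := by
  refine Finset.prod_ne_zero_iff.2 fun n _ => ?_
  rcases eq_zero_or_eq_one (h n) with hn | hn
  · simpa [hn] using G.bracket_div_ne a n
  · have han : a ≠ n := by
      rintro rfl
      rw [ha] at hn
      exact zero_ne_one hn
    simpa [hn, G.q_ne] using G.bracket_eta_ne han

lemma ne_of_label {h : Conf N} {a n : Fin N} (ha : h a = 0) (hn : h n = 1) : a ≠ n := by
  rintro rfl
  rw [ha] at hn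
  exact zero_ne_one hn

lemma bra_vecMul_opD (G : Generic q η) (h : Conf N) : ∀ u, u ≠ 0 →
    (∀ n, h n = 1 → bracket u (η n) ≠ 0) →
      bra q η ν h ᵥ* opD q η u = eigD q η h u • bra q η ν h := by
  induction h using conf_induction with
  | zero =>
    intro u _ _
    rw [bra_zero, Matrix.smul_vecMul, refState_vecMul_opD, eigD_zero, smul_comm]
  | step h a ha ih =>
    intro u hu hn
    have hua : bracket u (η a) ≠ 0 := hn a (by simp)
    have ih₁ := ih u hu fun n h1 => hn n (by
      rw [Function.update_of_ne (ne_of_label ha h1).symm, h1])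
    have ih₂ := ih (η a) (G.eta_ne a) fun n h1 => G.bracket_eta_ne (ne_of_label ha h1)
    -- This vanishing removes the unwanted term of the exchange relation.
    rw [eigD_eta ha, zero_smul] at ih₂
    have rel := congrArg (fun M => bra q η ν h ᵥ* M)
      (opD_mul_opC G.q_ne G.eta_ne hu (G.eta_ne a))
    simp only [Matrix.vecMul_add, Matrix.vecMul_smul, ← Matrix.vecMul_vecMul, ih₁, ih₂,
      Matrix.zero_vecMul, smul_zero, add_zero, Matrix.smul_vecMul, smul_smul,
      ← eigD_update ha u] at rel
    rw [mul_smul] at rel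
    rw [bra_update G ha, Matrix.smul_vecMul, smul_comm,
      ← smul_right_injective _ hua rel]

/-- The inductive step cancels `bracket u (η a)`, so it misses the points `u = η a` with `h a = 1`.
The norm recursion needs exactly those; `opD_mulVec_ket` recovers them by continuity. -/
lemma ket_eigD_of_bracket_ne (G : Generic q η) (h : Conf N) : ∀ u, u ≠ 0 →
    (∀ n, h n = 1 → bracket u (η n) ≠ 0) →
      opD q η u *ᵥ ket q η ν h = eigD q η h u • ket q η ν h := by
  induction h using conf_induction with
  | zero =>
    intro u _ _
    rw [ket_zero, Matrix.mulVec_smul, opD_mulVec_refState, eigD_zero, smul_comm]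
  | step h a ha ih =>
    intro u hu hn
    have hua : bracket u (η a) ≠ 0 := hn a (by simp)
    have ih₁ := ih u hu fun n h1 => hn n (by
      rw [Function.update_of_ne (ne_of_label ha h1).symm, h1])
    have ih₂ := ih (η a) (G.eta_ne a) fun n h1 => G.bracket_eta_ne (ne_of_label ha h1)
    rw [eigD_eta ha, zero_smul] at ih₂
    have rel := congrArg (fun M => M *ᵥ ket q η ν h)
      (opD_mul_opB G.q_ne G.eta_ne hu (G.eta_ne a))
    simp only [Matrix.add_mulVec, Matrix.smul_mulVec, ← Matrix.mulVec_mulVec, ih₁, ih₂,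
      Matrix.mulVec_zero, smul_zero, add_zero, Matrix.mulVec_smul, smul_smul,
      ← eigD_update ha u] at rel
    rw [mul_smul] at rel
    rw [ket_update G ha, Matrix.mulVec_smul, smul_comm,
      smul_right_injective _ hua rel]

end States

/-! ### Removing the excluded spectral parameters -/

section Continuity

open Filter Topology

variable {N : ℕ} {q : ℂ} {η : Fin N → ℂ} {ν : ℂ}

lemma continuousAt_monodromy (hq : q ≠ 0) (hη : ∀ n, η n ≠ 0) {u : ℂ} (hu : u ≠ 0) :
    ContinuousAt (monodromy q η) u := by
  have hl : ∀ n, ContinuousAt (fun v => lax q n (v / η n)) u := by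
    intro n
    have hd : ContinuousAt (fun v : ℂ => v / η n) u := continuousAt_id.div_const _
    have h₁ : ContinuousAt (fun v : ℂ => (v / η n)⁻¹) u := hd.inv₀ (div_ne_zero hu (hη n))
    have h₂ : ContinuousAt (fun v : ℂ => (q * (v / η n))⁻¹) u :=
      (continuousAt_const.mul hd).inv₀ (mul_ne_zero hq (div_ne_zero hu (hη n)))
    have hp : ContinuousAt (fun v : ℂ => xPlus q (v / η n)) u :=
      ((((hd.mul continuousAt_const).sub h₂).add hd).sub h₁).div_const _
    have hm : ContinuousAt (fun v : ℂ => xMinus q (v / η n)) u :=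
      ((((hd.mul continuousAt_const).sub h₂).sub hd).add h₁).div_const _
    refine continuousAt_pi.2 fun i => continuousAt_pi.2 fun j => ?_
    fin_cases i <;> fin_cases j
    · exact (hp.smul continuousAt_const).add (hm.smul continuousAt_const)
    · exact continuousAt_const
    · exact continuousAt_const
    · exact (hp.smul continuousAt_const).sub (hm.smul continuousAt_const)
  have := tendsto_list_prod (f := fun n v => lax q n (v / η n)) (x := 𝓝 u)
    (a := fun n => lax q n (u / η n)) (List.finRange N).reverse fun n _ => hl n
  simpa only [ContinuousAt, funext monodromy_eq_chain, chain] using this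

lemma continuousAt_eigD (hq : q ≠ 0) (h : Conf N) {u : ℂ} (hu : u ≠ 0) :
    ContinuousAt (eigD q η h) u := by
  refine tendsto_finsetProd _ fun n _ => ?_
  have h₁ : ContinuousAt (fun v : ℂ => v * q ^ (h n : ℕ)) u := continuousAt_id.mul continuousAt_const
  exact (h₁.div_const _).sub (continuousAt_const.div h₁ (mul_ne_zero hu (pow_ne_zero _ hq)))

lemma eventually_bracket_ne (u v : ℂ) (hv : v ≠ 0) : ∀ᶠ w in 𝓝[≠] u, bracket w v ≠ 0 := by
  refine Filter.Eventually.filter_mono (nhdsNE_le_cofinite u) ?_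
  -- The point `0` is listed because `bracket 0 v` is `0` under the convention for division by zero.
  have : ({0, v, -v} : Set ℂ).Finite := by simp
  refine (Set.Finite.eventually_cofinite_notMem this).mono fun w hw => ?_
  simp only [Set.mem_insert_iff, Set.mem_singleton_iff, not_or] at hw
  refine bracket_ne_zero hw.1 hv fun h => ?_
  rcases sq_eq_sq_iff_eq_or_eq_neg.1 h with h | h
  exacts [hw.2.1 h, hw.2.2 h]

lemma opD_mulVec_ket (G : Generic q η) (h : Conf N) {u : ℂ} (hu : u ≠ 0) :
    opD q η u *ᵥ ket q η ν h = eigD q η h u • ket q η ν h := by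
  have hD : ContinuousAt (fun v => opD q η v *ᵥ ket q η ν h) u := by
    have h₁ : ContinuousAt (fun v => opD q η v) u :=
      continuousAt_pi.1 (continuousAt_pi.1 (continuousAt_monodromy G.q_ne G.eta_ne hu) 1) 1
    exact (Continuous.matrix_mulVec continuous_id continuous_const).continuousAt.comp h₁
  have hE : ContinuousAt (fun v => eigD q η h v • ket q η ν h) u :=
    (continuousAt_eigD G.q_ne h hu).smul continuousAt_const
  refine tendsto_nhds_unique_of_eventuallyEq (hD.tendsto.mono_left nhdsWithin_le_nhds)
    (hE.tendsto.mono_left nhdsWithin_le_nhds) (l := 𝓝[≠] u) ?_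
  have h₀ : ∀ᶠ v in 𝓝[≠] u, v ≠ 0 :=
    (eventually_ne_nhds hu).filter_mono nhdsWithin_le_nhds
  filter_upwards [h₀, eventually_all.2 fun n => eventually_bracket_ne u (η n) (G.eta_ne n)]
    with v hv hb
  exact ket_eigD_of_bracket_ne G h v hv fun n _ => hb n

end Continuity

/-! ### Orthogonality and the norm recursion -/

section Pairing

variable {N : ℕ} {q : ℂ} {η : Fin N → ℂ} {ν : ℂ}

lemma bra_dotProduct_ket_of_ne (G : Generic q η) {h h' : Conf N} (hne : h ≠ h') :
    bra q η ν h ⬝ᵥ ket q η ν h' = 0 := by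
  obtain ⟨a, ha⟩ := Function.ne_iff.1 hne
  have hu : η a / q ≠ 0 := div_ne_zero (G.eta_ne a) G.q_ne
  -- At `η a / q` the eigenvalue detects the label at `a`, so the two ways of evaluating `D` here
  -- disagree unless the pairing vanishes.
  have e := Matrix.dotProduct_mulVec (bra q η ν h) (opD q η (η a / q)) (ket q η ν h')
  rw [opD_mulVec_ket G h' hu, bra_vecMul_opD G h _ hu fun n _ => G.bracket_div_ne a n,
    dotProduct_smul, smul_dotProduct, smul_eq_mul, smul_eq_mul] at e
  rcases eq_zero_or_eq_one (h a) with h0 | h1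
  · have h1' : h' a = 1 := (eq_zero_or_eq_one (h' a)).resolve_left fun h => ha (h0.trans h.symm)
    rw [eigD_eta_div G.q_ne h1', zero_mul] at e
    exact (mul_eq_zero.1 e.symm).resolve_left (G.eigD_eta_div_ne h0)
  · have h0' : h' a = 0 := (eq_zero_or_eq_one (h' a)).resolve_right fun h => ha (h1.trans h.symm)
    rw [eigD_eta_div G.q_ne h1, zero_mul] at e
    exact (mul_eq_zero.1 e).resolve_left (G.eigD_eta_div_ne h0')

lemma bracket_eta_div (hq : q ≠ 0) {x : ℂ} (hx : x ≠ 0) : bracket x (x / q) = q - q⁻¹ := by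
  unfold bracket
  field_simp

lemma norm_update (G : Generic q η) {h : Conf N} {a : Fin N} (ha : h a = 0) :
    (bra q η ν (Function.update h a 1) ⬝ᵥ ket q η ν (Function.update h a 1)) *
        eigD q η h (η a / q) =
      -eigD q η (Function.update h a 1) (η a) * (bra q η ν h ⬝ᵥ ket q η ν h) := by
  have hu : η a / q ≠ 0 := div_ne_zero (G.eta_ne a) G.q_ne
  have hbra₀ : bra q η ν h ᵥ* opD q η (η a) = 0 := by
    rw [bra_vecMul_opD G h _ (G.eta_ne a) fun n h1 => G.bracket_eta_ne (ne_of_label ha h1),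
      eigD_eta ha, zero_smul]
  have hket₀ : opD q η (η a) *ᵥ ket q η ν h = 0 := by
    rw [opD_mulVec_ket G h (G.eta_ne a), eigD_eta ha, zero_smul]
  have hbra := bra_vecMul_opD (ν := ν) G h _ hu fun n _ => G.bracket_div_ne a n
  have hket := opD_mulVec_ket (ν := ν) G (Function.update h a 1) (G.eta_ne a)
  set k := ket q η ν (Function.update h a 1) with hk
  -- At these arguments both coefficients on the right equal `q - q⁻¹`, while the left side dies
  -- because `D(η a)` annihilates the bra.
  have rel := congrArg (fun M => bra q η ν h ⬝ᵥ (M *ᵥ k))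
    (opD_mul_opC G.q_ne G.eta_ne (G.eta_ne a) hu)
  have e₁ : bra q η ν h ⬝ᵥ ((opD q η (η a) * opC q η (η a / q)) *ᵥ k) = 0 := by
    rw [← Matrix.mulVec_mulVec, Matrix.dotProduct_mulVec, hbra₀, zero_dotProduct]
  have e₂ : bra q η ν h ⬝ᵥ ((opC q η (η a / q) * opD q η (η a)) *ᵥ k) =
      eigD q η (Function.update h a 1) (η a) * (bra q η ν h ⬝ᵥ (opC q η (η a / q) *ᵥ k)) := by
    rw [← Matrix.mulVec_mulVec, hket, Matrix.mulVec_smul, dotProduct_smul, smul_eq_mul]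
  have e₃ : bra q η ν h ⬝ᵥ ((opD q η (η a / q) * opC q η (η a)) *ᵥ k) =
      eigD q η h (η a / q) * (bra q η ν h ⬝ᵥ (opC q η (η a) *ᵥ k)) := by
    rw [← Matrix.mulVec_mulVec, Matrix.dotProduct_mulVec, hbra, smul_dotProduct, smul_eq_mul]
  simp only [Matrix.add_mulVec, Matrix.smul_mulVec, dotProduct_add, dotProduct_smul, e₁, e₂, e₃,
    bracket_eta_div G.q_ne (G.eta_ne a), smul_eq_mul, mul_zero] at rel
  rw [← mul_add] at rel
  have rel' := (mul_eq_zero.1 rel.symm).resolve_left G.q_sub_ne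
  -- In the quantum determinant the `A D` term drops out, since `D(η a)` annihilates the ket
  -- labelled by `h`.
  have e₄ : bra q η ν h ⬝ᵥ (opC q η (η a / q) *ᵥ k) =
      dFun η (η a / q) * (bra q η ν h ⬝ᵥ ket q η ν h) := by
    have hdet := congrArg (fun M => bra q η ν h ⬝ᵥ (M *ᵥ ket q η ν h))
      (monodromy_qdet G.q_ne G.eta_ne (G.eta_ne a))
    simp only [Matrix.sub_mulVec, Matrix.smul_mulVec, ← Matrix.mulVec_mulVec, hket₀,
      Matrix.mulVec_zero, zero_sub, dotProduct_neg, Matrix.one_mulVec, dotProduct_smul,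
      smul_eq_mul, neg_mul, neg_inj] at hdet
    rw [hk, ket_update G ha, Matrix.mulVec_smul, dotProduct_smul, hdet, smul_eq_mul, mul_assoc,
      inv_mul_cancel_left₀ (G.aFun_ne a)]
  have e₅ : bra q η ν (Function.update h a 1) ⬝ᵥ k =
      (dFun η (η a / q))⁻¹ * (bra q η ν h ⬝ᵥ (opC q η (η a) *ᵥ k)) := by
    rw [bra_update G ha, smul_dotProduct, smul_eq_mul, Matrix.dotProduct_mulVec]
  rw [e₄] at rel'
  rw [e₅]
  have hd := G.dFun_ne a
  field_simp
  linear_combination rel'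

end Pairing

/-! ### Products over ordered pairs of sites -/

section PairProducts

variable {N : ℕ}

/-- A product over pairs of sites of a symmetric function which is trivial on the pairs avoiding
`a` reduces to the pairs containing `a`. -/
lemma prod_pairs_eq_prod_erase {M : Type*} [CommMonoid M] {r : Fin N → Fin N → M} {a : Fin N}
    (hsymm : ∀ x y, x ≠ y → r x y = r y x)
    (hone : ∀ x y, x ≠ y → x ≠ a → y ≠ a → r x y = 1) :
    ∏ x, ∏ y ∈ Finset.Iio x, r x y = ∏ y ∈ Finset.univ.erase a, r a y := by
  have h₁ : ∀ x, x ≠ a → ∏ y ∈ Finset.Iio x, r x y = if a < x then r a x else 1 := by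
    intro x hx
    split_ifs with hax
    · rw [hsymm a x hx.symm]
      refine Finset.prod_eq_single a (fun y hy hya => ?_) (fun h => ?_)
      · exact hone x y (Finset.mem_Iio.1 hy).ne' hx hya
      · exact absurd (Finset.mem_Iio.2 hax) h
    · refine Finset.prod_eq_one fun y hy => ?_
      have hy' := Finset.mem_Iio.1 hy
      exact hone x y hy'.ne' hx fun h => hax (h ▸ hy')
  rw [← Finset.mul_prod_erase _ _ (Finset.mem_univ a),
    Finset.prod_congr rfl fun x hx => h₁ x (Finset.ne_of_mem_erase hx),
    ← Finset.prod_filter_mul_prod_filter_not (Finset.univ.erase a) (fun y => a < y) (r a),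
    mul_comm, Finset.prod_filter]
  congr 1
  refine Finset.prod_congr ?_ fun _ _ => rfl
  ext y
  simp only [Finset.mem_Iio, Finset.mem_filter, Finset.mem_erase, Finset.mem_univ, and_true,
    not_lt]
  exact ⟨fun h => ⟨h.ne, h.le⟩, fun h => lt_of_le_of_ne h.2 h.1⟩

/-- Each site lies in exactly `N - 1` pairs. -/
lemma prod_pairs_mul {M : Type*} [CommMonoid M] (y : Fin N → M) :
    ∏ a, ∏ b ∈ Finset.Iio a, (y a * y b) = ∏ b, y b ^ (N - 1) := by
  have h : ∏ a : Fin N, ∏ b ∈ Finset.Iio a, y b = ∏ b : Fin N, ∏ _a ∈ Finset.Ioi b, y b :=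
    Finset.prod_comm' (by simp)
  simp only [Finset.prod_mul_distrib]
  rw [h, ← Finset.prod_mul_distrib]
  refine Finset.prod_congr rfl fun b _ => ?_
  rw [Finset.prod_const, Finset.prod_const, ← pow_add, Fin.card_Iio, Fin.card_Ioi]
  congr 1
  omega

end PairProducts

/-! ### Closed form of the norms and resolution of the identity -/

section Norm

variable {N : ℕ} {q : ℂ} {η : Fin N → ℂ} {ν : ℂ}

/-- The factor of `1 / ⟨h|h⟩` attached to the pair of sites `a`, `b`. -/
noncomputable def pairFactor (q : ℂ) (η : Fin N → ℂ) (h : Conf N) (a b : Fin N) : ℂ :=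
  bracket (η a * q ^ (hInt h b - hInt h a)) (η b)

lemma hInt_zero {h : Conf N} {a : Fin N} (ha : h a = 0) : hInt h a = 0 := by simp [hInt, ha]

lemma hInt_one {h : Conf N} {a : Fin N} (ha : h a = 1) : hInt h a = 1 := by simp [hInt, ha]

lemma Generic.pairFactor_ne (G : Generic q η) (h : Conf N) {a b : Fin N} (hab : a ≠ b) :
    pairFactor q η h a b ≠ 0 := by
  refine G.bracket_ne a b hab _ ?_
  rcases eq_zero_or_eq_one (h a) with ha | ha <;> rcases eq_zero_or_eq_one (h b) with hb | hb <;>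
    simp [hInt, ha, hb]

lemma pairFactor_swap (q : ℂ) (η : Fin N → ℂ) (h : Conf N) (a b : Fin N) :
    pairFactor q η h b a = -pairFactor q η h a b := by
  rw [pairFactor, bracket_mul_left, bracket_swap, pairFactor, div_eq_mul_inv, ← _root_.zpow_neg,
    neg_sub]

lemma eigD_eta_div_eq (G : Generic q η) {h : Conf N} {a : Fin N} (ha : h a = 0) :
    eigD q η h (η a / q) =
      -(q - q⁻¹) * ∏ b ∈ Finset.univ.erase a, pairFactor q η (Function.update h a 1) a b := by
  rw [eigD, ← Finset.mul_prod_erase _ _ (Finset.mem_univ a), ha]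
  congr 1
  · simp [bracket_swap (η a), bracket_eta_div G.q_ne (G.eta_ne a)]
  · refine Finset.prod_congr rfl fun b hb => ?_
    rw [pairFactor, hInt_one (Function.update_self a 1 h), hInt,
      Function.update_of_ne (Finset.ne_of_mem_erase hb), zpow_sub_one₀ G.q_ne, zpow_natCast,
      div_mul_eq_mul_div, ← mul_assoc, div_eq_mul_inv]

lemma eigD_update_eta_eq (G : Generic q η) {h : Conf N} {a : Fin N} (ha : h a = 0) :
    eigD q η (Function.update h a 1) (η a) =
      (q - q⁻¹) * ∏ b ∈ Finset.univ.erase a, pairFactor q η h a b := by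
  rw [eigD, ← Finset.mul_prod_erase _ _ (Finset.mem_univ a), Function.update_self]
  congr 1
  · rw [Fin.val_one, pow_one, bracket_mul_left, bracket_eta_div G.q_ne (G.eta_ne a)]
  · refine Finset.prod_congr rfl fun b hb => ?_
    rw [pairFactor, hInt_zero ha, hInt, Function.update_of_ne (Finset.ne_of_mem_erase hb),
      sub_zero, zpow_natCast]

/-- Raising one label changes only the pairs containing `a`. Pair factors are antisymmetric, so
their ratios are symmetric and `prod_pairs_eq_prod_erase` applies. -/
lemma prod_pairFactor_update (G : Generic q η) (h : Conf N) (a : Fin N) :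
    (∏ x, ∏ y ∈ Finset.Iio x, pairFactor q η (Function.update h a 1) x y) *
        ∏ b ∈ Finset.univ.erase a, pairFactor q η h a b =
      (∏ x, ∏ y ∈ Finset.Iio x, pairFactor q η h x y) *
        ∏ b ∈ Finset.univ.erase a, pairFactor q η (Function.update h a 1) a b := by
  have key := prod_pairs_eq_prod_erase (a := a)
    (r := fun x y => pairFactor q η (Function.update h a 1) x y / pairFactor q η h x y)
    (fun x y _ => by
      rw [pairFactor_swap q η _ y x, pairFactor_swap q η h y x, neg_div_neg_eq])
    (fun x y hxy hx hy => by
      have : pairFactor q η (Function.update h a 1) x y = pairFactor q η h x y := by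
        simp only [pairFactor, hInt, Function.update_of_ne hx, Function.update_of_ne hy]
      rw [this, div_self (G.pairFactor_ne h hxy)])
  simp only [Finset.prod_div_distrib] at key
  rwa [div_eq_div_iff, mul_comm _ (∏ x, ∏ y ∈ Finset.Iio x, pairFactor q η h x y)] at key
  · exact Finset.prod_ne_zero_iff.2 fun x _ => Finset.prod_ne_zero_iff.2 fun y hy =>
      G.pairFactor_ne h (Finset.mem_Iio.1 hy).ne'
  · exact Finset.prod_ne_zero_iff.2 fun y hy => G.pairFactor_ne h (Finset.ne_of_mem_erase hy).symm

lemma Generic.prod_pairFactor_ne (G : Generic q η) (h : Conf N) :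
    ∏ a, ∏ b ∈ Finset.Iio a, pairFactor q η h a b ≠ 0 :=
  Finset.prod_ne_zero_iff.2 fun _ _ => Finset.prod_ne_zero_iff.2 fun _ hb =>
    G.pairFactor_ne h (Finset.mem_Iio.1 hb).ne'

lemma bra_dotProduct_ket_self (G : Generic q η)
    (hν : ν ^ 2 = ∏ a : Fin N, ∏ b ∈ Finset.Iio a, bracket (η a) (η b)) (h : Conf N) :
    bra q η ν h ⬝ᵥ ket q η ν h = (∏ a, ∏ b ∈ Finset.Iio a, pairFactor q η h a b)⁻¹ := by
  induction h using conf_induction with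
  | zero =>
    have : ∀ a b, pairFactor q η (fun _ => 0) a b = bracket (η a) (η b) := fun a b => by
      simp [pairFactor, hInt]
    simp only [this, ← hν]
    rw [bra_zero, ket_zero, smul_dotProduct, dotProduct_smul, refState,
      single_dotProduct, Pi.single_eq_same]
    simp [sq]
  | step h a ha ih =>
    have e := norm_update (ν := ν) G ha
    have hne : ∏ b ∈ Finset.univ.erase a, pairFactor q η (Function.update h a 1) a b ≠ 0 :=
      Finset.prod_ne_zero_iff.2 fun y hy => G.pairFactor_ne _ (Finset.ne_of_mem_erase hy).symm
    have hc := G.q_sub_ne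
    have h₁ := G.prod_pairFactor_ne h
    have h₂ := G.prod_pairFactor_ne (Function.update h a 1)
    have hr := prod_pairFactor_update G h a
    rw [ih, eigD_eta_div_eq G ha, eigD_update_eta_eq G ha] at e
    refine eq_inv_of_mul_eq_one_left ?_
    refine mul_right_cancel₀ (mul_ne_zero (mul_ne_zero hc hne) h₁) ?_
    generalize bra q η ν (Function.update h a 1) ⬝ᵥ ket q η ν (Function.update h a 1) = X at *
    generalize ∏ x, ∏ y ∈ Finset.Iio x, pairFactor q η (Function.update h a 1) x y = P' at *
    generalize ∏ x, ∏ y ∈ Finset.Iio x, pairFactor q η h x y = P at *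
    generalize ∏ b ∈ Finset.univ.erase a, pairFactor q η (Function.update h a 1) a b = Q' at *
    generalize ∏ b ∈ Finset.univ.erase a, pairFactor q η h a b = Q at *
    have e' : X * ((q - q⁻¹) * Q') * P = (q - q⁻¹) * Q := by
      have := congrArg (· * P) e
      rw [mul_assoc (-_), inv_mul_cancel₀ h₁] at this
      linear_combination -this
    linear_combination P' * e' + (q - q⁻¹) * hr

/-- With `x_a = η_a q^{-h_a}` the pair factor is `x_a/x_b - x_b/x_a = (x_a² - x_b²)/(x_a x_b)`,
which yields the Vandermonde form. -/
lemma pairFactor_eq_div (G : Generic q η) (h : Conf N) (a b : Fin N) :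
    pairFactor q η h a b =
      (η a ^ 2 * q ^ (-2 * hInt h a) - η b ^ 2 * q ^ (-2 * hInt h b)) /
        ((η a * q ^ (-hInt h a)) * (η b * q ^ (-hInt h b))) := by
  have hsq : ∀ k : ℤ, q ^ (-2 * k) = (q ^ (-k)) ^ 2 := fun k => by
    rw [show -2 * k = -k * 2 by ring, _root_.zpow_mul]; rfl
  have hz := fun k : ℤ => zpow_ne_zero k G.q_ne
  have ha := G.eta_ne a
  have hb := G.eta_ne b
  rw [pairFactor, sub_eq_neg_add, zpow_add₀ G.q_ne, hsq, hsq]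
  have e : q ^ hInt h b = (q ^ (-hInt h b))⁻¹ := by rw [_root_.zpow_neg, inv_inv]
  rw [e]
  have h₁ := hz (-hInt h a)
  have h₂ := hz (-hInt h b)
  unfold bracket
  field_simp

lemma prod_pairFactor_eq_div (G : Generic q η) (h : Conf N) :
    ∏ a, ∏ b ∈ Finset.Iio a, pairFactor q η h a b =
      (∏ a : Fin N, ∏ b ∈ Finset.Iio a,
          (η a ^ 2 * q ^ (-2 * hInt h a) - η b ^ 2 * q ^ (-2 * hInt h b))) /
        ∏ b : Fin N, omega N (η b * q ^ (-hInt h b)) := by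
  simp only [pairFactor_eq_div G, Finset.prod_div_distrib]
  congr 1
  rw [prod_pairs_mul fun a => η a * q ^ (-hInt h a)]
  refine Finset.prod_congr rfl fun b _ => ?_
  -- The site `b` forces `N > 0`, so truncated and integer subtraction agree.
  have hN : ((N : ℤ) - 1) = ((N - 1 : ℕ) : ℤ) := by
    have := b.pos
    omega
  rw [omega, hN, zpow_natCast]

lemma one_eq_sum_ketBra (horth : ∀ h h' : Conf N, h ≠ h' → bra q η ν h ⬝ᵥ ket q η ν h' = 0)
    (hne : ∀ h, bra q η ν h ⬝ᵥ ket q η ν h ≠ 0) :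
    (1 : Op N) = ∑ h : Conf N, sklyaninMeasure q η ν h • ketBra q η ν h := by
  have e : (Matrix.diagonal (sklyaninMeasure q η ν) * matUL q η ν) * matUR q η ν = 1 := by
    ext h h'
    rw [Matrix.mul_assoc, Matrix.diagonal_mul]
    change sklyaninMeasure q η ν h * (bra q η ν h ⬝ᵥ ket q η ν h') = _
    by_cases hh : h = h'
    · subst hh
      rw [Matrix.one_apply_eq, sklyaninMeasure, one_div_mul_cancel (hne h)]
    · rw [horth h h' hh, mul_zero, Matrix.one_apply_ne hh]
  -- A one-sided inverse of a square matrix is two-sided; the reversed product is the completeness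
  -- sum.
  rw [← mul_eq_one_comm.1 e]
  ext s t
  rw [Matrix.mul_apply, Matrix.sum_apply]
  refine Finset.sum_congr rfl fun h _ => ?_
  rw [Matrix.diagonal_mul, Matrix.smul_apply, ketBra, Matrix.vecMulVec_apply, smul_eq_mul,
    mul_left_comm]
  rfl

end Norm

end XXZ

open XXZ Matrix in
/-- `ν` is any square root of `∏_{b<a} (η_a/η_b - η_b/η_a)`, i.e. any choice of the branches in
`∏_{b<a} (η_a/η_b - η_b/η_a)^{1/2}`. -/
theorem mainTheorem7 (N : ℕ) (q : ℂ) (η : Fin N → ℂ) (ν : ℂ)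
    (hq : q ≠ 0) (hq2 : q ^ 2 ≠ 1) (hη : ∀ n, η n ≠ 0)
    (hsov : ∀ a b : Fin N, b < a → ∀ j ∈ ({-1, 0, 1} : Set ℤ), η a ^ 2 ≠ q ^ (2 * j) * η b ^ 2)
    (hν : ν ^ 2 = ∏ a : Fin N, ∏ b ∈ Finset.Iio a, (η a / η b - η b / η a)) :
    (matM q η ν).IsDiag ∧
    (∀ h : Conf N,
      matM q η ν h h = bra q η ν h ⬝ᵥ ket q η ν h ∧
      bra q η ν h ⬝ᵥ ket q η ν h =
        ∏ a : Fin N, ∏ b ∈ Finset.Iio a,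
          1 / (η a * q ^ (hInt h b - hInt h a) / η b - η b / (q ^ (hInt h b - hInt h a) * η a)) ∧
      bra q η ν h ⬝ᵥ ket q η ν h ≠ 0) ∧
    (1 : Op N) = ∑ h : Conf N, sklyaninMeasure q η ν h • ketBra q η ν h ∧
    (1 : Op N) = ∑ h : Conf N,
      ((∏ a : Fin N, ∏ b ∈ Finset.Iio a,
          (η a ^ 2 * q ^ (-2 * hInt h a) - η b ^ 2 * q ^ (-2 * hInt h b))) /
        ∏ b : Fin N, omega N (η b * q ^ (-hInt h b))) • ketBra q η ν h := by
  have G : Generic q η := Generic.of_lt hq hq2 hη hsov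
  have hnorm := bra_dotProduct_ket_self (ν := ν) G hν
  have horth : ∀ h h' : Conf N, h ≠ h' → bra q η ν h ⬝ᵥ ket q η ν h' = 0 :=
    fun h h' hne => bra_dotProduct_ket_of_ne G hne
  have hne : ∀ h, bra q η ν h ⬝ᵥ ket q η ν h ≠ 0 := fun h => by
    rw [hnorm]
    exact inv_ne_zero (G.prod_pairFactor_ne h)
  have hone := one_eq_sum_ketBra horth hne
  refine ⟨fun h h' => horth h h', fun h => ⟨rfl, ?_, hne h⟩, hone, ?_⟩
  · simp only [hnorm, ← Finset.prod_inv_distrib, one_div]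
    refine Finset.prod_congr rfl fun a _ => Finset.prod_congr rfl fun b _ => ?_
    rw [pairFactor, bracket, mul_comm (q ^ _) (η a)]
  · refine hone.trans (Finset.sum_congr rfl fun h _ => ?_)
    rw [← prod_pairFactor_eq_div G, sklyaninMeasure, hnorm, one_div, inv_inv]
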